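/- Let $d \ge 1$, let $Z \sim \mathcal N(0,I_d)$ have law $\mu$, let $|\cdot|$ be the Euclidean norm and $\mathbf B(x,r)$ the closed ball. Let $\varphi:\mathbb R^d\to\mathbb R$ be continuous and not identically zero, and assume that there are $A,B\ge 0$ such that $|\varphi(z)|\le Ae^{B|z|}$ for all $z\in\mathbb R^d$ and, for every $r>0$, the restriction of $\varphi$ to $\mathbf B(0,r)$ is Lipschitz with constant $Ae^{Br}$. Define $$v(x,z)=\varphi^2(z)\,e^{-\langle x,z\rangle+|x|^2/2},\qquad V(x)=\mathbb E[v(x,Z)],\qquad x,z\in\mathbb R^d .$$ **1.** The assumptions of the convergence theorem for empiric minimizers hold, that is (here with latent dimension $q=d$): - $V$ is finite, continuous, positive and coercive ($V(x)\to+\infty$ as $|x|\to\infty$), and $v$ is continuous and nonnegative. - (i) $\int |z|^r\mu(dz)<\infty$ for some $r>q/(q-1)$ if $q\neq1$, for some $r>2$ if $q=1$. - (ii) There is a compact set $\mathcal Q\subset\mathbb R^q$ with $\mathbb P(Z\in\mathcal Q)>0$ such that $x\mapsto\inf_{z\in\mathcal Q}v(x,z)$ is coercive. - (iii) For every $M>0$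 there are constants $C,C'>0$ such that $\sup_{x\in\mathbf B(0,M)}\mathbb E[v(x,Z)\mathbf 1_{Z\notin\mathbf B(0,R)}]\le Ce^{-C'R^2}$ for all $R\ge0$; and there are constants $C,C'>0$ such that, for every compact $\mathcal K\subset\mathbb R^q$ and every $x\in\mathbf B(0,M)$, the function $v(x,\cdot)$ is Lipschitz on $\mathcal K$ with constant $Ce^{C'\mathrm{Radius}(\mathcal K)}$, where $\mathrm{Radius}(\mathcal K)=\sup_{z\in\mathcal K}|z|$ (and $0$ if $\mathcal K=\emptyset$). - (iv) There is a global minimizer $x^\star$ of $V$ with $\mathbb E[v^2(x^\star,Z)]<\infty$. **2.** For all $n\ge1$ and $z_1,\dots,z_n\in\mathbb R^d$ the function $x\mapsto\frac1n\sum_{i=1}^n v(x,z_i)$ attains its minimum on $\mathbb R^d$. **3.** Let $V^\star=\min V$ and let $\mathcal R_d(n)=n^{-1/2}$ if $d=1$, $n^{-1/2}\log(1+n)$ if $d=2$, and $n^{-1/d}$ if $d>2$. There are a constant $C>0$ and a positive sequence $(a_n)$ with $a_n=o(n^\varepsilon)$ for every $\varepsilon>0$ such that the following holds. For all i.i.d.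 $Z_1,Z_2,\dots\sim\mathcal N(0,I_d)$ on a probability space, with $V_n(x)=\frac1n\sum_{i=1}^n v(x,Z_i)$, and all $X_n^\star$ that almost surely belong to $\operatorname{argmin}V_n$ for each $n\ge1$, the variable $V_n(X_n^\star)-V^\star$ is integrable and $$\mathbb E|V_n(X_n^\star)-V^\star|\le C\,a_n\,\mathcal R_d(n)\qquad\text{for all } n\ge1 .$$ -/

import Mathlib

open MeasureTheory ProbabilityTheory Filter Topology Asymptotics

noncomputable section

namespace EmpiricMinimizer

/-- The Euclidean space `ℝ^k` with its canonical Euclidean norm. -/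
abbrev Euc (k : ℕ) : Type := EuclideanSpace ℝ (Fin k)

/-- A function is coercive if it tends to `+∞` as `|x| → ∞`. -/
def Coercive {k : ℕ} (f : Euc k → ℝ) : Prop :=
  Tendsto f (Bornology.cobounded (Euc k)) atTop

/-- `argmin f`, the (possibly empty) set of global minimizers of `f`. -/
def argminSet {k : ℕ} (f : Euc k → ℝ) : Set (Euc k) :=
  {x | ∀ y, f x ≤ f y}

/-- `Radius(K) = sup {|x| : x ∈ K}`; it is used for bounded sets only, and the radius of the
empty set is `0`. -/
def radius {k : ℕ} (K : Set (Euc k)) : ℝ :=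
  sSup ((fun x => ‖x‖) '' K)

/-- The rate `R_q(n)`: `n^{-1/2}` if `q = 1`, `n^{-1/2} log(1+n)` if `q = 2`, and `n^{-1/q}`
if `q > 2`. -/
def rate (q n : ℕ) : ℝ :=
  if q = 1 then (n : ℝ) ^ (-(1 / 2) : ℝ)
  else if q = 2 then (n : ℝ) ^ (-(1 / 2) : ℝ) * Real.log (1 + n)
  else (n : ℝ) ^ (-(1 / (q : ℝ)))

/-- The empirical objective `V_n(x) = (1/n) ∑_{i<n} v(x, z_i)` built on the first `n` terms of
the sequence `z`. -/
def empiricalObjective {d q : ℕ} (v : Euc d → Euc q → ℝ) (n : ℕ) (z : ℕ → Euc q)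
    (x : Euc d) : ℝ :=
  (1 / (n : ℝ)) * ∑ i ∈ Finset.range n, v x (z i)

/-- The standing assumptions together with the hypotheses (i)-(iv) of the convergence theorem for
empiric minimizers, for an objective `V : ℝ^d → ℝ`, a function `v : ℝ^d × ℝ^q → ℝ` and the law
`μ` of the random vector `Z` with values in `ℝ^q`. -/
structure ConvergenceAssumptions {d q : ℕ} (μ : Measure (Euc q)) (V : Euc d → ℝ)
    (v : Euc d → Euc q → ℝ) : Prop where
  isProbabilityMeasure : IsProbabilityMeasure μ
  continuous_V : Continuous V
  pos_V : ∀ x, 0 < V x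
  coercive_V : Coercive V
  continuous_v : Continuous (fun p : Euc d × Euc q => v p.1 p.2)
  nonneg_v : ∀ x z, 0 ≤ v x z
  /-- `E[v(x, Z)]` is finite -/
  integrable_v : ∀ x, Integrable (v x) μ
  /-- `E[v(x, Z)] = V(x)` -/
  integral_v : ∀ x, ∫ z, v x z ∂μ = V x
  /-- (i) `μ` has a finite moment of some order `r > q/(q-1)` (`r > 2` if `q = 1`) -/
  moment : ∃ r : ℝ, (if q = 1 then 2 < r else (q : ℝ) / ((q : ℝ) - 1) < r) ∧
    ∫⁻ z, ENNReal.ofReal (‖z‖ ^ r) ∂μ < ⊤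
  /-- (ii) coercivity, uniformly over a compact set charged by `μ` -/
  coercive_inf : ∃ Q : Set (Euc q), IsCompact Q ∧ 0 < μ Q ∧
    Coercive (fun x : Euc d => ⨅ z : Q, v x z)
  /-- (iii), first part: Gaussian tails outside balls, locally uniformly in `x` -/
  tail : ∀ M : ℝ, 0 < M → ∃ C C' : ℝ, 0 < C ∧ 0 < C' ∧ ∀ R : ℝ, 0 ≤ R →
    ∀ x ∈ Metric.closedBall (0 : Euc d) M,
      ∫ z in (Metric.closedBall (0 : Euc q) R)ᶜ, v x z ∂μ ≤ C * Real.exp (-(C' * R ^ 2))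
  /-- (iii), second part: Lipschitz constants on compact sets, locally uniformly in `x` -/
  lipschitz : ∀ M : ℝ, 0 < M → ∃ C C' : ℝ, 0 < C ∧ 0 < C' ∧ ∀ K : Set (Euc q), IsCompact K →
    ∀ x ∈ Metric.closedBall (0 : Euc d) M,
      LipschitzOnWith (Real.toNNReal (C * Real.exp (C' * radius K))) (v x) K
  /-- (iv) square integrability at some minimizer -/
  second_moment : ∃ xs ∈ argminSet V, Integrable (fun z => v xs z ^ 2) μ

/-- `v(x, z) = φ(z)² exp(-⟨x, z⟩ + |x|²/2)`, the integrand of importance sampling by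
translation. -/
def importanceIntegrand {d : ℕ} (φ : Euc d → ℝ) (x z : Euc d) : ℝ :=
  φ z ^ 2 * Real.exp (-(inner ℝ x z) + ‖x‖ ^ 2 / 2)

/-- `V(x) = E[v(x, Z)]` with `Z ~ N(0, I_d)`. -/
def importanceObjective {d : ℕ} (φ : Euc d → ℝ) (x : Euc d) : ℝ :=
  ∫ z, importanceIntegrand φ x z ∂(stdGaussian (Euc d))

end EmpiricMinimizer

end

namespace EmpiricMinimizer

/-! ### Gaussian integrability of functions of exponential growth -/

variable {d : ℕ}

/-! Fernique's theorem makes every continuous function of exponential growth square integrable for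
the Gaussian law. On a ball where `φ ^ 2 ≥ δ`, the integrand dominates `δ * exp (|x|²/2 - R|x|)`.
These two bounds give nearly all the assumptions, and the second also yields empirical minimizers.

The error bound uses no uniform law of large numbers. For fixed `z`, `v(·, z)` is the exponential of
a quadratic, and `exp u ≥ 1 + u` gives `v(x + h, z) ≥ v(x, z) + ⟨∇v(x, z), h⟩ + v(x, z)|h|²/2`.
Averaging at a minimizer `xs` of `V`, with `m = V(xs)` and `g_n` the empirical gradient at `xs`,
bounds `|min V_n - m|` by `2|V_n(xs) - m| + |g_n|²/m` (`abs_empiricalObjective_sub_le`). Both terms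
are empirical means at the single point `xs`, and `g_n` is centred by the first-order condition.
Variances then give the rate `n^{-1/2}` in every dimension, so `a_n = 1` suffices. -/

lemma mul_le_sq_add_sq {k t c : ℝ} (hc : 0 < c) : k * t ≤ c * t ^ 2 + k ^ 2 / (4 * c) := by
  have h : c * t ^ 2 + k ^ 2 / (4 * c) - k * t = (2 * c * t - k) ^ 2 / (4 * c) := by
    field_simp
    ring
  have : 0 ≤ (2 * c * t - k) ^ 2 / (4 * c) := by positivity
  linarith

instance isOpenPosMeasure_gaussianReal : (gaussianReal 0 1).IsOpenPosMeasure :=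
  (gaussianReal_absolutelyContinuous' 0 one_ne_zero).isOpenPosMeasure

/-- Makes balls on which `φ ^ 2` is bounded below have positive mass. The law is the image of a
product measure under a continuous surjection. -/
instance isOpenPosMeasure_stdGaussian : (stdGaussian (Euc d)).IsOpenPosMeasure := by
  rw [← map_pi_eq_stdGaussian]
  exact (PiLp.continuous_toLp 2 _).isOpenPosMeasure_map (WithLp.toLp_surjective 2)

/-- Fernique: `exp (c‖z‖²)` is integrable for some `c > 0`, and completing the square absorbs the
linear exponent. -/
lemma integrable_exp_mul_norm (k : ℝ) :
    Integrable (fun z : Euc d => Real.exp (k * ‖z‖)) (stdGaussian (Euc d)) := by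
  obtain ⟨c, hc, h⟩ := IsGaussian.exists_integrable_exp_sq (stdGaussian (Euc d))
  refine (h.mul_const (Real.exp (k ^ 2 / (4 * c)))).mono' (by fun_prop) (ae_of_all _ fun z => ?_)
  rw [Real.norm_of_nonneg (Real.exp_pos _).le, ← Real.exp_add]
  exact Real.exp_le_exp.2 (mul_le_sq_add_sq hc)

/-- At most exponential growth. -/
def ExpGrowth {d : ℕ} (f : Euc d → ℝ) : Prop :=
  ∃ K k : ℝ, ∀ z, |f z| ≤ K * Real.exp (k * ‖z‖)

lemma ExpGrowth.mul {f g : Euc d → ℝ} (hf : ExpGrowth f) (hg : ExpGrowth g) :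
    ExpGrowth (fun z => f z * g z) := by
  obtain ⟨K, k, hf⟩ := hf
  obtain ⟨L, l, hg⟩ := hg
  refine ⟨K * L, k + l, fun z => ?_⟩
  calc |f z * g z| = |f z| * |g z| := abs_mul _ _
    _ ≤ (K * Real.exp (k * ‖z‖)) * (L * Real.exp (l * ‖z‖)) :=
        mul_le_mul (hf z) (hg z) (abs_nonneg _) ((abs_nonneg _).trans (hf z))
    _ = K * L * Real.exp ((k + l) * ‖z‖) := by rw [add_mul, Real.exp_add]; ring

lemma ExpGrowth.pow_two {f : Euc d → ℝ} (hf : ExpGrowth f) : ExpGrowth (fun z => f z ^ 2) := by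
  simpa only [sq] using hf.mul hf

lemma ExpGrowth.integrable {f : Euc d → ℝ} (hf : ExpGrowth f) (hc : Continuous f) :
    Integrable f (stdGaussian (Euc d)) := by
  obtain ⟨K, k, hf⟩ := hf
  exact ((integrable_exp_mul_norm k).const_mul K).mono' (by fun_prop) (ae_of_all _ hf)

lemma ExpGrowth.memLp_two {f : Euc d → ℝ} (hf : ExpGrowth f) (hc : Continuous f) :
    MemLp f 2 (stdGaussian (Euc d)) :=
  (memLp_two_iff_integrable_sq (by fun_prop)).2 (hf.pow_two.integrable (by fun_prop))

/-! ### Growth of the integrand and continuity of the objective -/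

lemma abs_neg_inner_le (x z : Euc d) : |-(inner ℝ x z)| ≤ ‖x‖ * ‖z‖ := by
  rw [abs_neg]; exact abs_real_inner_le_norm x z

lemma importanceIntegrand_nonneg (φ : Euc d → ℝ) (x z : Euc d) :
    0 ≤ importanceIntegrand φ x z := by
  unfold importanceIntegrand; positivity

lemma continuous_importanceIntegrand {φ : Euc d → ℝ} (hφ : Continuous φ) :
    Continuous (fun p : Euc d × Euc d => importanceIntegrand φ p.1 p.2) := by
  unfold importanceIntegrand; fun_prop

lemma continuous_importanceIntegrand_left (φ : Euc d → ℝ) (z : Euc d) :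
    Continuous (fun x => importanceIntegrand φ x z) := by
  unfold importanceIntegrand; fun_prop

lemma continuous_importanceIntegrand_right {φ : Euc d → ℝ} (hφ : Continuous φ) (x : Euc d) :
    Continuous (importanceIntegrand φ x) := by
  unfold importanceIntegrand; fun_prop

lemma importanceIntegrand_le {φ : Euc d → ℝ} {A B M : ℝ}
    (hgrowth : ∀ z, |φ z| ≤ A * Real.exp (B * ‖z‖)) {x : Euc d} (hx : ‖x‖ ≤ M) (z : Euc d) :
    importanceIntegrand φ x z
      ≤ A ^ 2 * Real.exp (M ^ 2 / 2) * Real.exp ((2 * B + M) * ‖z‖) := by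
  have h1 : φ z ^ 2 ≤ A ^ 2 * Real.exp (2 * B * ‖z‖) := by
    calc φ z ^ 2 = |φ z| ^ 2 := (sq_abs _).symm
      _ ≤ (A * Real.exp (B * ‖z‖)) ^ 2 := pow_le_pow_left₀ (abs_nonneg _) (hgrowth z) 2
      _ = A ^ 2 * Real.exp (2 * B * ‖z‖) := by
        rw [mul_pow, ← Real.exp_nat_mul]; congr 2; push_cast; ring
  have h2 : Real.exp (-(inner ℝ x z) + ‖x‖ ^ 2 / 2) ≤ Real.exp (M * ‖z‖ + M ^ 2 / 2) := by
    apply Real.exp_le_exp.2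
    have h3 := (le_abs_self _).trans (abs_neg_inner_le x z)
    have h4 : ‖x‖ * ‖z‖ ≤ M * ‖z‖ := by gcongr
    have h5 : ‖x‖ ^ 2 ≤ M ^ 2 := by gcongr
    linarith
  calc importanceIntegrand φ x z
      ≤ (A ^ 2 * Real.exp (2 * B * ‖z‖)) * Real.exp (M * ‖z‖ + M ^ 2 / 2) := by
        unfold importanceIntegrand; gcongr
    _ = _ := by rw [add_mul, Real.exp_add, Real.exp_add]; ring

lemma expGrowth_importanceIntegrand {φ : Euc d → ℝ} {A B : ℝ}
    (hgrowth : ∀ z, |φ z| ≤ A * Real.exp (B * ‖z‖)) (x : Euc d) :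
    ExpGrowth (importanceIntegrand φ x) :=
  ⟨_, _, fun z => by
    rw [abs_of_nonneg (importanceIntegrand_nonneg _ _ _)]
    exact importanceIntegrand_le hgrowth le_rfl z⟩

lemma integrable_importanceIntegrand {φ : Euc d → ℝ} (hφ : Continuous φ) {A B : ℝ}
    (hgrowth : ∀ z, |φ z| ≤ A * Real.exp (B * ‖z‖)) (x : Euc d) :
    Integrable (importanceIntegrand φ x) (stdGaussian (Euc d)) :=
  (expGrowth_importanceIntegrand hgrowth x).integrable
    (continuous_importanceIntegrand_right hφ x)

lemma continuous_importanceObjective {φ : Euc d → ℝ} (hφ : Continuous φ) {A B : ℝ}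
    (hgrowth : ∀ z, |φ z| ≤ A * Real.exp (B * ‖z‖)) : Continuous (importanceObjective φ) := by
  refine continuous_iff_continuousAt.2 fun x => ?_
  refine continuousAt_of_dominated (bound := fun z =>
      A ^ 2 * Real.exp ((‖x‖ + 1) ^ 2 / 2) * Real.exp ((2 * B + (‖x‖ + 1)) * ‖z‖)) ?_ ?_ ?_ ?_
  · exact Eventually.of_forall fun y =>
      (continuous_importanceIntegrand_right hφ y).aestronglyMeasurable
  · filter_upwards [Metric.ball_mem_nhds x one_pos] with y hy
    refine ae_of_all _ fun z => ?_
    rw [Real.norm_of_nonneg (importanceIntegrand_nonneg _ _ _)]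
    refine importanceIntegrand_le hgrowth ?_ z
    have h1 : ‖y - x‖ < 1 := by rwa [mem_ball_iff_norm] at hy
    have h2 : ‖y‖ ≤ ‖x‖ + ‖y - x‖ := by simpa using norm_add_le x (y - x)
    linarith
  · exact (integrable_exp_mul_norm _).const_mul _
  · exact ae_of_all _ fun z => (continuous_importanceIntegrand_left φ z).continuousAt

/-! ### Coercivity -/

lemma coercive_mul_exp {δ : ℝ} (hδ : 0 < δ) (R : ℝ) :
    Coercive (fun x : Euc d => δ * Real.exp (‖x‖ ^ 2 / 2 - R * ‖x‖)) := by
  refine Tendsto.const_mul_atTop hδ (Real.tendsto_exp_atTop.comp ?_)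
  have h : Tendsto (fun t : ℝ => t * (t / 2 - R)) atTop atTop := by
    refine tendsto_id.atTop_mul_atTop₀ ?_
    simpa [sub_eq_add_neg] using
      tendsto_atTop_add_const_right atTop (-R) (tendsto_id.atTop_div_const (two_pos (α := ℝ)))
  refine (h.comp (tendsto_norm_cobounded_atTop (E := Euc d))).congr fun x => ?_
  simp only [Function.comp_apply]; ring

/-- The common source of coercivity for `V`, for the infimum over a compact set and for the
empirical objective. -/
lemma le_importanceIntegrand (φ : Euc d → ℝ) {δ R : ℝ} {x z : Euc d} (hδ : δ ≤ φ z ^ 2)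
    (hz : ‖z‖ ≤ R) :
    δ * Real.exp (‖x‖ ^ 2 / 2 - R * ‖x‖) ≤ importanceIntegrand φ x z := by
  unfold importanceIntegrand
  have h1 := (abs_le.1 (abs_neg_inner_le x z)).1
  have h2 : ‖x‖ * ‖z‖ ≤ ‖x‖ * R := by gcongr
  refine mul_le_mul hδ (Real.exp_le_exp.2 (by linarith)) (Real.exp_pos _).le (sq_nonneg _)

lemma exists_closedBall_le_sq {φ : Euc d → ℝ} (hφ : Continuous φ) (hne : ∃ z, φ z ≠ 0) :
    ∃ (z₀ : Euc d) (r δ : ℝ), 0 < r ∧ 0 < δ ∧ ∀ z ∈ Metric.closedBall z₀ r, δ ≤ φ z ^ 2 := by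
  obtain ⟨z₀, h0⟩ := hne
  have hpos : 0 < φ z₀ ^ 2 := by positivity
  have : ∀ᶠ z in 𝓝 z₀, φ z₀ ^ 2 / 2 < φ z ^ 2 :=
    (hφ.pow 2).continuousAt.eventually_const_lt (half_lt_self hpos)
  obtain ⟨r, hr, h⟩ := Metric.nhds_basis_closedBall.eventually_iff.1 this
  exact ⟨z₀, r, φ z₀ ^ 2 / 2, hr, half_pos hpos, fun z hz => (h hz).le⟩

lemma norm_le_of_mem_closedBall {z₀ z : Euc d} {r : ℝ} (hz : z ∈ Metric.closedBall z₀ r) :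
    ‖z‖ ≤ ‖z₀‖ + r := by
  have h1 : ‖z - z₀‖ ≤ r := by rwa [mem_closedBall_iff_norm] at hz
  have h2 : ‖z‖ ≤ ‖z₀‖ + ‖z - z₀‖ := by simpa using norm_add_le z₀ (z - z₀)
  linarith

lemma exists_const_le_importanceObjective {φ : Euc d → ℝ} (hφ : Continuous φ)
    (hne : ∃ z, φ z ≠ 0) {A B : ℝ} (hgrowth : ∀ z, |φ z| ≤ A * Real.exp (B * ‖z‖)) :
    ∃ δ R : ℝ, 0 < δ ∧
      ∀ x, δ * Real.exp (‖x‖ ^ 2 / 2 - R * ‖x‖) ≤ importanceObjective φ x := by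
  obtain ⟨z₀, r, δ, hr, hδ, h⟩ := exists_closedBall_le_sq hφ hne
  have hμ : 0 < (stdGaussian (Euc d)).real (Metric.closedBall z₀ r) :=
    ENNReal.toReal_pos (Metric.measure_closedBall_pos _ _ hr).ne' (measure_ne_top _ _)
  refine ⟨(stdGaussian (Euc d)).real (Metric.closedBall z₀ r) * δ, ‖z₀‖ + r, by positivity,
    fun x => ?_⟩
  have hint := integrable_importanceIntegrand hφ hgrowth x
  calc _ = ∫ _ in Metric.closedBall z₀ r, δ * Real.exp (‖x‖ ^ 2 / 2 - (‖z₀‖ + r) * ‖x‖)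
          ∂(stdGaussian (Euc d)) := by simp [mul_assoc]
    _ ≤ ∫ z in Metric.closedBall z₀ r, importanceIntegrand φ x z ∂(stdGaussian (Euc d)) :=
        setIntegral_mono_on (integrable_const _).integrableOn hint.integrableOn
          Metric.isClosed_closedBall.measurableSet
          fun z hz => le_importanceIntegrand φ (h z hz) (norm_le_of_mem_closedBall hz)
    _ ≤ importanceObjective φ x :=
        setIntegral_le_integral hint (ae_of_all _ (importanceIntegrand_nonneg φ x))

lemma Coercive.mono {k : ℕ} {f g : Euc k → ℝ} (hf : Coercive f) (h : ∀ x, f x ≤ g x) :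
    Coercive g :=
  tendsto_atTop_mono h hf

lemma Coercive.argminSet_nonempty {k : ℕ} {f : Euc k → ℝ} (hf : Coercive f)
    (hc : Continuous f) : (argminSet f).Nonempty := by
  have h : Tendsto f (cocompact (Euc k)) atTop := by
    rw [← Metric.cobounded_eq_cocompact]; exact hf
  exact hc.exists_forall_le h

lemma coercive_iInf_importanceIntegrand {φ : Euc d → ℝ} {Q : Set (Euc d)} {δ R : ℝ}
    (hδ : 0 < δ) (hQ : Q.Nonempty) (hφQ : ∀ z ∈ Q, δ ≤ φ z ^ 2) (hR : ∀ z ∈ Q, ‖z‖ ≤ R) :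
    Coercive (fun x : Euc d => ⨅ z : Q, importanceIntegrand φ x z) := by
  have := hQ.to_subtype
  exact (coercive_mul_exp hδ R).mono fun x =>
    le_ciInf fun z => le_importanceIntegrand φ (hφQ z z.2) (hR z z.2)

/-! ### Gaussian tails and local Lipschitz constants -/

lemma tail_importanceIntegrand {φ : Euc d → ℝ} (hφ : Continuous φ) {A B : ℝ}
    (hgrowth : ∀ z, |φ z| ≤ A * Real.exp (B * ‖z‖)) (M : ℝ) :
    ∃ C C' : ℝ, 0 < C ∧ 0 < C' ∧ ∀ R : ℝ, 0 ≤ R →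
      ∀ x ∈ Metric.closedBall (0 : Euc d) M,
        ∫ z in (Metric.closedBall (0 : Euc d) R)ᶜ, importanceIntegrand φ x z
          ∂(stdGaussian (Euc d)) ≤ C * Real.exp (-(C' * R ^ 2)) := by
  obtain ⟨c, hc, hint⟩ := IsGaussian.exists_integrable_exp_sq (stdGaussian (Euc d))
  set D := A ^ 2 * Real.exp (M ^ 2 / 2) * Real.exp ((2 * B + M) ^ 2 / (4 * (c / 2))) with hD
  have hD0 : 0 ≤ D := by positivity
  have hI0 : 0 ≤ ∫ z, Real.exp (c * ‖z‖ ^ 2) ∂(stdGaussian (Euc d)) :=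
    integral_nonneg fun z => (Real.exp_pos _).le
  -- Half of Fernique's exponent `c` produces the decay in `R`; the other half absorbs the linear
  -- exponent, whence `c / 2` in `D`. The `+ 1` keeps the constant positive when `A = 0`.
  refine ⟨D * ∫ z, Real.exp (c * ‖z‖ ^ 2) ∂(stdGaussian (Euc d)) + 1, c / 2, by positivity,
    by positivity, fun R hR x hx => ?_⟩
  have hx' : ‖x‖ ≤ M := by simpa using hx
  have key : ∀ z ∈ (Metric.closedBall (0 : Euc d) R)ᶜ, importanceIntegrand φ x z
      ≤ D * Real.exp (-(c / 2 * R ^ 2)) * Real.exp (c * ‖z‖ ^ 2) := by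
    intro z hz
    have hz' : R < ‖z‖ := by simpa using hz
    have hz2 : c / 2 * R ^ 2 ≤ c / 2 * ‖z‖ ^ 2 := by gcongr
    refine (importanceIntegrand_le hgrowth hx' z).trans ?_
    rw [hD, mul_assoc (A ^ 2 * _), mul_assoc (A ^ 2 * _), ← Real.exp_add, ← Real.exp_add]
    refine mul_le_mul_of_nonneg_left (Real.exp_le_exp.2 ?_) (by positivity)
    have := mul_le_sq_add_sq (k := 2 * B + M) (t := ‖z‖) (half_pos hc)
    linarith
  calc ∫ z in (Metric.closedBall (0 : Euc d) R)ᶜ, importanceIntegrand φ x z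
          ∂(stdGaussian (Euc d))
      ≤ ∫ z in (Metric.closedBall (0 : Euc d) R)ᶜ,
          D * Real.exp (-(c / 2 * R ^ 2)) * Real.exp (c * ‖z‖ ^ 2) ∂(stdGaussian (Euc d)) :=
        setIntegral_mono_on (integrable_importanceIntegrand hφ hgrowth x).integrableOn
          (hint.const_mul _).integrableOn Metric.isClosed_closedBall.measurableSet.compl key
    _ ≤ ∫ z, D * Real.exp (-(c / 2 * R ^ 2)) * Real.exp (c * ‖z‖ ^ 2)
          ∂(stdGaussian (Euc d)) :=
        setIntegral_le_integral (hint.const_mul _) (ae_of_all _ fun z => by positivity)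
    _ = (D * ∫ z, Real.exp (c * ‖z‖ ^ 2) ∂(stdGaussian (Euc d))) *
          Real.exp (-(c / 2 * R ^ 2)) := by rw [integral_const_mul]; ring
    _ ≤ _ := by gcongr; linarith

/-- For `b ≤ a`, factor out `exp a` and use `1 - exp (b - a) ≤ a - b`. -/
lemma abs_exp_sub_exp_le {a b m : ℝ} (ha : a ≤ m) (hb : b ≤ m) :
    |Real.exp a - Real.exp b| ≤ Real.exp m * |a - b| := by
  wlog h : b ≤ a generalizing a b
  · rw [abs_sub_comm, abs_sub_comm a b]; exact this hb ha (le_of_not_ge h)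
  rw [abs_of_nonneg (sub_nonneg.2 (Real.exp_le_exp.2 h)), abs_of_nonneg (sub_nonneg.2 h)]
  have h1 : Real.exp b = Real.exp a * Real.exp (b - a) := by rw [← Real.exp_add]; ring_nf
  have h2 := Real.add_one_le_exp (b - a)
  calc Real.exp a - Real.exp b = Real.exp a * (1 - Real.exp (b - a)) := by rw [h1]; ring
    _ ≤ Real.exp a * (a - b) :=
      mul_le_mul_of_nonneg_left (by linarith) (Real.exp_pos a).le
    _ ≤ Real.exp m * (a - b) := by
      have := sub_nonneg.2 h
      gcongr

lemma norm_le_radius {k : ℕ} {K : Set (Euc k)} (hK : IsCompact K) {z : Euc k} (hz : z ∈ K) :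
    ‖z‖ ≤ radius K :=
  le_csSup (hK.image continuous_norm).bddAbove ⟨z, hz, rfl⟩

lemma lipschitz_importanceIntegrand {φ : Euc d → ℝ} {A B : ℝ} (hA : 0 ≤ A)
    (hgrowth : ∀ z, |φ z| ≤ A * Real.exp (B * ‖z‖)) (hB : 0 ≤ B)
    (hlip : ∀ r : ℝ, 0 < r →
      LipschitzOnWith (Real.toNNReal (A * Real.exp (B * r))) φ
        (Metric.closedBall (0 : Euc d) r)) {M : ℝ} (hM : 0 < M) :
    ∃ C C' : ℝ, 0 < C ∧ 0 < C' ∧ ∀ K : Set (Euc d), IsCompact K →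
      ∀ x ∈ Metric.closedBall (0 : Euc d) M,
        LipschitzOnWith (Real.toNNReal (C * Real.exp (C' * radius K)))
          (importanceIntegrand φ x) K := by
  -- `2 * A ^ 2` comes from the variation of `φ ^ 2`, `A ^ 2 * M` from that of the exponential; the
  -- `+ 1` ensures positivity when `A = 0`.
  refine ⟨(2 * A ^ 2 + A ^ 2 * M + 1) * Real.exp (M ^ 2 / 2), 2 * B + M, by positivity,
    by positivity, fun K hK x hx => LipschitzOnWith.of_dist_le_mul fun z hz w hw => ?_⟩
  have hx' : ‖x‖ ≤ M := by simpa using hx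
  rw [Real.coe_toNNReal _ (by positivity)]
  have hzr := norm_le_radius hK hz
  have hwr := norm_le_radius hK hw
  set r := radius K
  rcases eq_or_ne z w with rfl | hzw
  · simp
  -- `hlip` covers positive radii only; two distinct points of `K` force `radius K > 0`.
  have hr : 0 < r := by
    rcases (norm_nonneg z).eq_or_lt' with h | h
    · refine lt_of_lt_of_le (norm_pos_iff.2 ?_) hwr
      rintro rfl
      exact hzw (norm_eq_zero.1 h)
    · exact h.trans_le hzr
  set E := Real.exp (B * r) with hE
  have hφb : ∀ y : Euc d, ‖y‖ ≤ r → |φ y| ≤ A * E := fun y hy =>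
    (hgrowth y).trans (by rw [hE]; gcongr)
  have hφl : |φ z - φ w| ≤ A * E * ‖z - w‖ := by
    have := (hlip r hr).dist_le_mul z (by simpa using hzr) w (by simpa using hwr)
    rwa [Real.coe_toNNReal _ (by positivity), Real.dist_eq, dist_eq_norm] at this
  have hφ2 : |φ z ^ 2 - φ w ^ 2| ≤ 2 * A ^ 2 * E ^ 2 * ‖z - w‖ := by
    calc |φ z ^ 2 - φ w ^ 2| = |φ z + φ w| * |φ z - φ w| := by
          rw [← abs_mul]; congr 1; ring
      _ ≤ (A * E + A * E) * (A * E * ‖z - w‖) := by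
          gcongr
          exact (abs_add_le _ _).trans (add_le_add (hφb z hzr) (hφb w hwr))
      _ = _ := by ring
  have hexp : ∀ y : Euc d, ‖y‖ ≤ r → -(inner ℝ x y) + ‖x‖ ^ 2 / 2 ≤ M * r + M ^ 2 / 2 := by
    intro y hy
    have h3 := (le_abs_self _).trans (abs_neg_inner_le x y)
    have h4 : ‖x‖ * ‖y‖ ≤ M * r := by gcongr
    have h5 : ‖x‖ ^ 2 ≤ M ^ 2 := by gcongr
    linarith
  have hel := abs_exp_sub_exp_le (hexp z hzr) (hexp w hwr)
  have hil : |(-(inner ℝ x z) + ‖x‖ ^ 2 / 2) - (-(inner ℝ x w) + ‖x‖ ^ 2 / 2)|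
      ≤ M * ‖z - w‖ := by
    have : (-(inner ℝ x z) + ‖x‖ ^ 2 / 2) - (-(inner ℝ x w) + ‖x‖ ^ 2 / 2)
        = -(inner ℝ x (z - w)) := by rw [inner_sub_right]; ring
    rw [this]
    exact (abs_neg_inner_le x _).trans (by gcongr)
  have hw2 : |φ w ^ 2| ≤ A ^ 2 * E ^ 2 := by
    rw [abs_pow, ← mul_pow]
    exact pow_le_pow_left₀ (abs_nonneg _) (hφb w hwr) 2
  set F := Real.exp (M * r + M ^ 2 / 2) with hF
  have hprod : ∀ a b c e : ℝ, a * b - c * e = (a - c) * b + c * (b - e) := by intros; ring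
  rw [Real.dist_eq, dist_eq_norm]
  unfold importanceIntegrand
  rw [hprod]
  have hEF : E ^ 2 * F = Real.exp (M ^ 2 / 2) * Real.exp ((2 * B + M) * r) := by
    rw [hE, hF, ← Real.exp_nat_mul, ← Real.exp_add, ← Real.exp_add]
    congr 1; push_cast; ring
  calc _ ≤ 2 * A ^ 2 * E ^ 2 * ‖z - w‖ * F + A ^ 2 * E ^ 2 * (F * (M * ‖z - w‖)) := by
        refine (abs_add_le _ _).trans ?_
        rw [abs_mul, abs_mul]
        refine add_le_add (mul_le_mul hφ2 ?_ (abs_nonneg _) (by positivity))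
          (mul_le_mul hw2 (hel.trans ?_) (abs_nonneg _) (by positivity))
        · rw [Real.abs_exp]; exact Real.exp_le_exp.2 (hexp z hzr)
        · gcongr
    _ = (2 * A ^ 2 + A ^ 2 * M) * (E ^ 2 * F) * ‖z - w‖ := by ring
    _ ≤ (2 * A ^ 2 + A ^ 2 * M + 1) * (E ^ 2 * F) * ‖z - w‖ := by gcongr ?_ * _ * _; linarith
    _ = _ := by rw [hEF]; ring

/-! ### Verification of the convergence assumptions -/

lemma exists_moment (hd : 1 ≤ d) :
    ∃ r : ℝ, (if d = 1 then 2 < r else (d : ℝ) / ((d : ℝ) - 1) < r) ∧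
      ∫⁻ z, ENNReal.ofReal (‖z‖ ^ r) ∂(stdGaussian (Euc d)) < ⊤ := by
  -- The order 3 serves every dimension, since `d / (d - 1) ≤ 2` for `d ≥ 2`.
  refine ⟨3, ?_, ?_⟩
  · split_ifs with h
    · norm_num
    · have h2 : (2 : ℝ) ≤ d := by exact_mod_cast (by omega : 2 ≤ d)
      rw [div_lt_iff₀ (by linarith)]
      linarith
  · have h : Integrable (fun z : Euc d => ‖z‖ ^ (3 : ℝ)) (stdGaussian (Euc d)) := by
      have := (IsGaussian.memLp_id (stdGaussian (Euc d)) 3 (by simp)).integrable_norm_rpow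
        (by simp) (by simp)
      simpa using this
    exact h.lintegral_lt_top

theorem convergenceAssumptions_importance (hd : 1 ≤ d) {φ : Euc d → ℝ} (hφ : Continuous φ)
    (hne : ∃ z, φ z ≠ 0) {A B : ℝ} (hA : 0 ≤ A) (hB : 0 ≤ B)
    (hgrowth : ∀ z, |φ z| ≤ A * Real.exp (B * ‖z‖))
    (hlip : ∀ r : ℝ, 0 < r →
      LipschitzOnWith (Real.toNNReal (A * Real.exp (B * r))) φ
        (Metric.closedBall (0 : Euc d) r)) :
    ConvergenceAssumptions (stdGaussian (Euc d)) (importanceObjective φ)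
      (importanceIntegrand φ) := by
  obtain ⟨δ, R, hδ, hV⟩ := exists_const_le_importanceObjective hφ hne hgrowth
  have hcont := continuous_importanceObjective hφ hgrowth
  have hcoer : Coercive (importanceObjective φ) := (coercive_mul_exp hδ R).mono hV
  refine
  { isProbabilityMeasure := inferInstance
    continuous_V := hcont
    pos_V := fun x => lt_of_lt_of_le (by positivity) (hV x)
    coercive_V := hcoer
    continuous_v := continuous_importanceIntegrand hφ
    nonneg_v := importanceIntegrand_nonneg φ
    integrable_v := integrable_importanceIntegrand hφ hgrowth
    integral_v := fun x => rfl
    moment := exists_moment hd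
    coercive_inf := ?_
    tail := fun M _ => tail_importanceIntegrand hφ hgrowth M
    lipschitz := fun M hM => lipschitz_importanceIntegrand hA hgrowth hB hlip hM
    second_moment := ?_ }
  · obtain ⟨z₀, r, η, hr, hη, h⟩ := exists_closedBall_le_sq hφ hne
    exact ⟨Metric.closedBall z₀ r, isCompact_closedBall _ _,
      Metric.measure_closedBall_pos _ _ hr,
      coercive_iInf_importanceIntegrand hη (Metric.nonempty_closedBall.2 hr.le) h
        fun z hz => norm_le_of_mem_closedBall hz⟩
  · obtain ⟨xs, hxs⟩ := hcoer.argminSet_nonempty hcont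
    exact ⟨xs, hxs, (expGrowth_importanceIntegrand hgrowth xs).pow_two.integrable
      ((continuous_importanceIntegrand_right hφ xs).pow 2)⟩

/-! ### Existence of empirical minimizers -/

lemma continuous_empiricalObjective (φ : Euc d → ℝ) (n : ℕ) (z : ℕ → Euc d) :
    Continuous (empiricalObjective (importanceIntegrand φ) n z) :=
  continuous_const.mul
    (continuous_finsetSum _ fun i _ => continuous_importanceIntegrand_left φ (z i))

theorem argminSet_empiricalObjective_nonempty (φ : Euc d → ℝ) {n : ℕ} (hn : 1 ≤ n)
    (z : ℕ → Euc d) :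
    (argminSet (empiricalObjective (importanceIntegrand φ) n z)).Nonempty := by
  have hn0 : (0 : ℝ) < n := by exact_mod_cast hn
  -- One sample with `φ (z i) ≠ 0` already makes the average coercive; otherwise the average
  -- vanishes identically.
  by_cases h : ∃ i < n, φ (z i) ≠ 0
  · obtain ⟨i, hi, hφi⟩ := h
    have hδ : 0 < 1 / (n : ℝ) * φ (z i) ^ 2 := by positivity
    refine ((coercive_mul_exp hδ ‖z i‖).mono fun x => ?_).argminSet_nonempty
      (continuous_empiricalObjective φ n z)
    rw [mul_assoc]
    unfold empiricalObjective
    refine mul_le_mul_of_nonneg_left ?_ (by positivity)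
    exact (le_importanceIntegrand φ le_rfl le_rfl).trans
      (Finset.single_le_sum (f := fun i => importanceIntegrand φ x (z i))
        (fun j _ => importanceIntegrand_nonneg φ x _) (Finset.mem_range.2 hi))
  · push Not at h
    have h0 : ∀ x, empiricalObjective (importanceIntegrand φ) n z x = 0 := fun x => by
      unfold empiricalObjective
      rw [Finset.sum_eq_zero fun i hi => by
        simp [importanceIntegrand, h i (Finset.mem_range.1 hi)], mul_zero]
    exact ⟨0, fun y => by rw [h0, h0]⟩

/-! ### First-order condition at a minimizer -/

lemma importanceIntegrand_add (φ : Euc d → ℝ) (x h z : Euc d) :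
    importanceIntegrand φ (x + h) z =
      importanceIntegrand φ x z * Real.exp (inner ℝ (x - z) h + ‖h‖ ^ 2 / 2) := by
  unfold importanceIntegrand
  rw [mul_assoc, ← Real.exp_add, norm_add_sq_real, inner_add_left, inner_sub_left,
    real_inner_comm h z]
  congr 2
  ring

/-- Bounds the logarithmic derivative along `x + t • h` uniformly in `|t| ≤ 1`, with exponential
growth in `z`, as differentiation under the integral requires. -/
lemma abs_inner_sub_add_le (x h z : Euc d) {t : ℝ} (ht : |t| ≤ 1) :
    |inner ℝ (x - z) h + t * ‖h‖ ^ 2|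
      ≤ ((‖x‖ + 1) * ‖h‖ + ‖h‖ ^ 2) * Real.exp ‖z‖ := by
  have h1 : ‖z‖ + 1 ≤ Real.exp ‖z‖ := Real.add_one_le_exp _
  have h2 : (1 : ℝ) ≤ Real.exp ‖z‖ := by linarith [norm_nonneg z]
  have h3 : |inner ℝ (x - z) h| ≤ (‖x‖ + ‖z‖) * ‖h‖ :=
    (abs_real_inner_le_norm _ _).trans (by gcongr; exact norm_sub_le x z)
  have h4 : |t * ‖h‖ ^ 2| ≤ ‖h‖ ^ 2 * Real.exp ‖z‖ := by
    rw [abs_mul, abs_of_nonneg (sq_nonneg ‖h‖), mul_comm]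
    gcongr
    exact ht.trans h2
  have h5 : ‖x‖ + ‖z‖ ≤ (‖x‖ + 1) * Real.exp ‖z‖ := by
    nlinarith [norm_nonneg x]
  calc _ ≤ (‖x‖ + ‖z‖) * ‖h‖ + ‖h‖ ^ 2 * Real.exp ‖z‖ :=
        (abs_add_le _ _).trans (add_le_add h3 h4)
    _ ≤ (‖x‖ + 1) * Real.exp ‖z‖ * ‖h‖ + ‖h‖ ^ 2 * Real.exp ‖z‖ := by gcongr
    _ = _ := by ring

lemma expGrowth_inner_sub (x h : Euc d) : ExpGrowth (fun z => inner ℝ (x - z) h) :=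
  ⟨_, 1, fun z => by simpa using abs_inner_sub_add_le x h z (t := 0) (by simp)⟩

lemma hasDerivAt_importanceIntegrand (φ : Euc d → ℝ) (x h z : Euc d) (t : ℝ) :
    HasDerivAt (fun t : ℝ => importanceIntegrand φ (x + t • h) z)
      (importanceIntegrand φ (x + t • h) z * (inner ℝ (x - z) h + t * ‖h‖ ^ 2)) t := by
  have hfun : ∀ s : ℝ, importanceIntegrand φ (x + s • h) z =
      importanceIntegrand φ x z *
        Real.exp (s * inner ℝ (x - z) h + s ^ 2 * (‖h‖ ^ 2 / 2)) := fun s => by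
    rw [importanceIntegrand_add, inner_smul_right, norm_smul, mul_pow, Real.norm_eq_abs, sq_abs]
    congr 2
    ring
  simp_rw [hfun]
  have h1 : HasDerivAt (fun s : ℝ => s * inner ℝ (x - z) h + s ^ 2 * (‖h‖ ^ 2 / 2))
      (inner ℝ (x - z) h + t * ‖h‖ ^ 2) t := by
    convert! ((hasDerivAt_id t).mul_const (inner ℝ (x - z) h)).add
      ((hasDerivAt_pow 2 t).mul_const (‖h‖ ^ 2 / 2)) using 1
    simp
    ring
  convert! h1.exp.const_mul (importanceIntegrand φ x z) using 1
  ring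

/-- First-order condition at a minimizer of `V`. -/
lemma integral_importanceIntegrand_mul_inner_eq_zero {φ : Euc d → ℝ} (hφ : Continuous φ)
    {A B : ℝ} (hgrowth : ∀ z, |φ z| ≤ A * Real.exp (B * ‖z‖)) {xs : Euc d}
    (hxs : xs ∈ argminSet (importanceObjective φ)) (h : Euc d) :
    ∫ z, importanceIntegrand φ xs z * inner ℝ (xs - z) h ∂(stdGaussian (Euc d)) = 0 := by
  -- `M` bounds `‖xs + t • h‖` for all `|t| ≤ 1`.
  set M := ‖xs‖ + ‖h‖ with hM
  have hmeas : ∀ t : ℝ, Continuous (importanceIntegrand φ (xs + t • h)) := fun t =>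
    continuous_importanceIntegrand_right hφ _
  have hd : HasDerivAt (fun t : ℝ => importanceObjective φ (xs + t • h))
      (∫ z, importanceIntegrand φ (xs + (0 : ℝ) • h) z *
        (inner ℝ (xs - z) h + (0 : ℝ) * ‖h‖ ^ 2) ∂(stdGaussian (Euc d))) 0 := by
    refine (hasDerivAt_integral_of_dominated_loc_of_deriv_le (Metric.ball_mem_nhds 0 one_pos)
      (bound := fun z => (A ^ 2 * Real.exp (M ^ 2 / 2) * Real.exp ((2 * B + M) * ‖z‖)) *
        (((‖xs‖ + 1) * ‖h‖ + ‖h‖ ^ 2) * Real.exp ‖z‖))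
      (F := fun (t : ℝ) z => importanceIntegrand φ (xs + t • h) z)
      (F' := fun (t : ℝ) z => importanceIntegrand φ (xs + t • h) z *
        (inner ℝ (xs - z) h + t * ‖h‖ ^ 2)) ?_ ?_ ?_ ?_ ?_ ?_).2
    · exact Eventually.of_forall fun t => (hmeas t).aestronglyMeasurable
    · exact integrable_importanceIntegrand hφ hgrowth _
    · have := hmeas 0
      exact Continuous.aestronglyMeasurable (by fun_prop)
    · refine ae_of_all _ fun z t ht => ?_
      have ht' : |t| ≤ 1 := by
        have : |t| < 1 := by simpa using ht
        exact this.le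
      rw [Real.norm_eq_abs, abs_mul, abs_of_nonneg (importanceIntegrand_nonneg _ _ _)]
      refine mul_le_mul (importanceIntegrand_le hgrowth ?_ z) (abs_inner_sub_add_le xs h z ht')
        (abs_nonneg _) (by positivity)
      refine (norm_add_le _ _).trans (add_le_add le_rfl ?_)
      rw [norm_smul]
      exact mul_le_of_le_one_left (norm_nonneg h) ht'
    · refine ((integrable_exp_mul_norm (2 * B + M + 1)).const_mul
        (A ^ 2 * Real.exp (M ^ 2 / 2) * ((‖xs‖ + 1) * ‖h‖ + ‖h‖ ^ 2))).congr
        (ae_of_all _ fun z => ?_)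
      simp only []
      rw [show (2 * B + M + 1) * ‖z‖ = (2 * B + M) * ‖z‖ + ‖z‖ by ring, Real.exp_add]
      ring
    · exact ae_of_all _ fun z t _ => hasDerivAt_importanceIntegrand φ xs h z t
  have hmin : IsLocalMin (fun t : ℝ => importanceObjective φ (xs + t • h)) 0 :=
    Eventually.of_forall fun t => by simpa using hxs (xs + t • h)
  simpa using hmin.hasDerivAt_eq_zero hd

/-- The `j`-th coordinate of the gradient of `v(·, z)` at `x`. -/
noncomputable def importanceGradient (φ : Euc d → ℝ) (x : Euc d) (j : Fin d) (z : Euc d) : ℝ :=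
  importanceIntegrand φ x z * (x j - z j)

lemma importanceGradient_eq (φ : Euc d → ℝ) (x : Euc d) (j : Fin d) :
    importanceGradient φ x j = fun z =>
      importanceIntegrand φ x z * inner ℝ (x - z) (EuclideanSpace.single j (1 : ℝ)) := by
  funext z
  simp [importanceGradient, EuclideanSpace.inner_single_right]

lemma continuous_importanceGradient {φ : Euc d → ℝ} (hφ : Continuous φ) (x : Euc d)
    (j : Fin d) : Continuous (importanceGradient φ x j) := by
  have := continuous_importanceIntegrand_right hφ x
  unfold importanceGradient
  fun_prop

lemma memLp_importanceGradient {φ : Euc d → ℝ} (hφ : Continuous φ) {A B : ℝ}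
    (hgrowth : ∀ z, |φ z| ≤ A * Real.exp (B * ‖z‖)) (x : Euc d) (j : Fin d) :
    MemLp (importanceGradient φ x j) 2 (stdGaussian (Euc d)) := by
  refine ExpGrowth.memLp_two ?_ (continuous_importanceGradient hφ x j)
  rw [importanceGradient_eq]
  exact (expGrowth_importanceIntegrand hgrowth x).mul (expGrowth_inner_sub x _)

lemma integral_importanceGradient {φ : Euc d → ℝ} (hφ : Continuous φ) {A B : ℝ}
    (hgrowth : ∀ z, |φ z| ≤ A * Real.exp (B * ‖z‖)) {xs : Euc d}
    (hxs : xs ∈ argminSet (importanceObjective φ)) (j : Fin d) :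
    ∫ z, importanceGradient φ xs j z ∂(stdGaussian (Euc d)) = 0 := by
  rw [importanceGradient_eq]
  exact integral_importanceIntegrand_mul_inner_eq_zero hφ hgrowth hxs _

/-! ### Convexity bound for the empirical minimum -/

/-- The average of `f` over the first `n` terms of a sequence. -/
noncomputable def empiricalMean {𝓧 : Type*} (f : 𝓧 → ℝ) (n : ℕ) (z : ℕ → 𝓧) : ℝ :=
  (1 / (n : ℝ)) * ∑ i ∈ Finset.range n, f (z i)

/-- `v(y, z) ≥ v(x, z) + ⟨∇v(x, z), y - x⟩ + v(x, z) |y - x|² / 2`. -/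
lemma le_importanceIntegrand_add (φ : Euc d → ℝ) (x h z : Euc d) :
    importanceIntegrand φ x z + ∑ j, importanceGradient φ x j z * h j
      + importanceIntegrand φ x z * (‖h‖ ^ 2 / 2) ≤ importanceIntegrand φ (x + h) z := by
  have hsum : ∑ j, importanceGradient φ x j z * h j
      = importanceIntegrand φ x z * inner ℝ (x - z) h := by
    rw [PiLp.inner_apply, Finset.mul_sum]
    refine Finset.sum_congr rfl fun j _ => ?_
    simp [importanceGradient]
    ring
  rw [hsum, importanceIntegrand_add]
  -- `exp u ≥ 1 + u`, weighted by the nonnegative `v(x, z)`.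
  have := mul_le_mul_of_nonneg_left
    (Real.add_one_le_exp (inner ℝ (x - z) h + ‖h‖ ^ 2 / 2)) (importanceIntegrand_nonneg φ x z)
  linarith

lemma le_empiricalObjective_add (φ : Euc d → ℝ) (x h : Euc d) (n : ℕ) (z : ℕ → Euc d) :
    empiricalObjective (importanceIntegrand φ) n z x
      + ∑ j, empiricalMean (importanceGradient φ x j) n z * h j
      + empiricalObjective (importanceIntegrand φ) n z x * (‖h‖ ^ 2 / 2)
      ≤ empiricalObjective (importanceIntegrand φ) n z (x + h) := by
  have := mul_le_mul_of_nonneg_left (Finset.sum_le_sum fun i (_ : i ∈ Finset.range n) =>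
    le_importanceIntegrand_add φ x h (z i)) (by positivity : (0 : ℝ) ≤ 1 / (n : ℝ))
  refine le_trans (le_of_eq ?_) this
  unfold empiricalObjective empiricalMean
  simp only [Finset.sum_add_distrib, mul_add, Finset.mul_sum, Finset.sum_mul, mul_assoc]
  rw [Finset.sum_comm]

lemma empiricalObjective_nonneg (φ : Euc d → ℝ) (n : ℕ) (z : ℕ → Euc d) (x : Euc d) :
    0 ≤ empiricalObjective (importanceIntegrand φ) n z x :=
  mul_nonneg (by positivity) (Finset.sum_nonneg fun _ _ => importanceIntegrand_nonneg φ _ _)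

/-- If `V_n(xs) < m / 2`, then `m ≤ 2|V_n(xs) - m|` and nonnegativity of `V_n` suffices. Otherwise
the quadratic term has coefficient at least `m / 4` in `|x - xs|²`, and completing the square
against the linear term costs `|g_n|² / m`. -/
lemma sub_empiricalObjective_le (φ : Euc d → ℝ) (xs x : Euc d) (n : ℕ) (z : ℕ → Euc d)
    {m : ℝ} (hm : 0 < m) :
    m - empiricalObjective (importanceIntegrand φ) n z x
      ≤ 2 * |empiricalObjective (importanceIntegrand φ) n z xs - m|
        + (∑ j, empiricalMean (importanceGradient φ xs j) n z ^ 2) / m := by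
  have habs := neg_abs_le (empiricalObjective (importanceIntegrand φ) n z xs - m)
  rcases lt_or_ge (empiricalObjective (importanceIntegrand φ) n z xs) (m / 2) with hlt | hge
  · have h0 := empiricalObjective_nonneg φ n z x
    have : 0 ≤ (∑ j, empiricalMean (importanceGradient φ xs j) n z ^ 2) / m := by positivity
    linarith
  · have key := le_empiricalObjective_add φ xs (x - xs) n z
    rw [add_sub_cancel] at key
    have hcs : -((∑ j, empiricalMean (importanceGradient φ xs j) n z ^ 2) / m
          + m / 2 * (‖x - xs‖ ^ 2 / 2))
        ≤ ∑ j, empiricalMean (importanceGradient φ xs j) n z * (x - xs) j := by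
      rw [EuclideanSpace.real_norm_sq_eq, Finset.sum_div, Finset.sum_div, Finset.mul_sum,
        ← Finset.sum_add_distrib, ← Finset.sum_neg_distrib]
      refine Finset.sum_le_sum fun j _ => ?_
      set g := empiricalMean (importanceGradient φ xs j) n z
      set t := (x - xs) j
      have : 0 ≤ (g + m / 2 * t) ^ 2 / m := by positivity
      have h2 : (g + m / 2 * t) ^ 2 / m = g ^ 2 / m + m / 2 * (t ^ 2 / 2) + g * t := by
        field_simp
        ring
      linarith
    have hq : m / 2 * (‖x - xs‖ ^ 2 / 2)
        ≤ empiricalObjective (importanceIntegrand φ) n z xs * (‖x - xs‖ ^ 2 / 2) := by gcongr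
    have := abs_nonneg (empiricalObjective (importanceIntegrand φ) n z xs - m)
    linarith

lemma abs_empiricalObjective_sub_le {φ : Euc d → ℝ} (xs : Euc d) {x : Euc d} {n : ℕ}
    {z : ℕ → Euc d} (hx : x ∈ argminSet (empiricalObjective (importanceIntegrand φ) n z))
    {m : ℝ} (hm : 0 < m) :
    |empiricalObjective (importanceIntegrand φ) n z x - m|
      ≤ 2 * |empiricalObjective (importanceIntegrand φ) n z xs - m|
        + (∑ j, empiricalMean (importanceGradient φ xs j) n z ^ 2) / m := by
  refine abs_sub_le_iff.2 ⟨?_, sub_empiricalObjective_le φ xs x n z hm⟩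
  have h1 := hx xs
  have h2 := le_abs_self (empiricalObjective (importanceIntegrand φ) n z xs - m)
  have h3 := abs_nonneg (empiricalObjective (importanceIntegrand φ) n z xs - m)
  have : 0 ≤ (∑ j, empiricalMean (importanceGradient φ xs j) n z ^ 2) / m := by positivity
  linarith

/-! ### Variance of empirical means -/

section Sampling

variable {Ω 𝓧 : Type*} [MeasurableSpace Ω] [MeasurableSpace 𝓧] {P : Measure Ω}
  {μ : Measure 𝓧} {Z : ℕ → Ω → 𝓧} {f : 𝓧 → ℝ} {n : ℕ}

lemma memLp_empiricalMean (hZ : ∀ i, HasLaw (Z i) μ P) (hf : MemLp f 2 μ) :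
    MemLp (fun ω => empiricalMean f n (fun i => Z i ω)) 2 P := by
  have h : ∀ i, MemLp (fun ω => f (Z i ω)) 2 P := fun i =>
    MemLp.comp_of_map (by rwa [(hZ i).map_eq]) (hZ i).aemeasurable
  exact (memLp_finsetSum (Finset.range n) fun i _ => h i).const_mul _

lemma integral_sq_empiricalMean_sub [IsProbabilityMeasure P] (hZ : ∀ i, HasLaw (Z i) μ P)
    (hind : iIndepFun Z P) (hfm : Measurable f) (hf : MemLp f 2 μ) (hn : 1 ≤ n) :
    ∫ ω, (empiricalMean f n (fun i => Z i ω) - ∫ z, f z ∂μ) ^ 2 ∂P = Var[f; μ] / n := by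
  have hn0 : (n : ℝ) ≠ 0 := by positivity
  have h : ∀ i, MemLp (fun ω => f (Z i ω)) 2 P := fun i =>
    MemLp.comp_of_map (by rwa [(hZ i).map_eq]) (hZ i).aemeasurable
  have hmean : ∫ ω, empiricalMean f n (fun i => Z i ω) ∂P = ∫ z, f z ∂μ := by
    unfold empiricalMean
    rw [integral_const_mul, integral_finsetSum _ fun i _ => (h i).integrable (by norm_num)]
    have : ∀ i ∈ Finset.range n, ∫ ω, f (Z i ω) ∂P = ∫ z, f z ∂μ := fun i _ =>
      (hZ i).integral_comp hf.aestronglyMeasurable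
    rw [Finset.sum_congr rfl this]
    simp [hn0]
  rw [← hmean, ← variance_eq_integral (memLp_empiricalMean hZ hf).aestronglyMeasurable.aemeasurable]
  unfold empiricalMean
  rw [variance_const_mul]
  have hsum : Var[fun ω => ∑ i ∈ Finset.range n, f (Z i ω); P] = n * Var[f; μ] := by
    have := IndepFun.variance_sum (s := Finset.range n) (X := fun i ω => f (Z i ω))
      (fun i _ => h i)
      (fun i _ j _ hij => (hind.indepFun hij).comp hfm hfm)
    rw [Finset.sum_fn] at this
    rw [this]
    have hv : ∀ i ∈ Finset.range n, Var[fun ω => f (Z i ω); P] = Var[f; μ] := fun i _ => by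
      rw [← (hZ i).map_eq, variance_map (by rw [(hZ i).map_eq]; exact hfm.aemeasurable)
        (hZ i).aemeasurable]
      rfl
    rw [Finset.sum_congr rfl hv]
    simp
  rw [hsum]
  field_simp

end Sampling

/-! ### Measurability of the minimal value -/

lemma eq_iInf_denseSeq {k : ℕ} {f : Euc k → ℝ} (hf : Continuous f) {x : Euc k}
    (hx : x ∈ argminSet f) : f x = ⨅ i, f (TopologicalSpace.denseSeq (Euc k) i) := by
  refine le_antisymm (le_ciInf fun i => hx _) ?_
  refine (TopologicalSpace.denseRange_denseSeq (Euc k)).induction_on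
    (p := fun y => ⨅ i, f (TopologicalSpace.denseSeq (Euc k) i) ≤ f y) x
    (isClosed_le continuous_const hf) fun i => ciInf_le ⟨f x, ?_⟩ i
  rintro _ ⟨j, rfl⟩
  exact hx _

/-- The selection `X` need not be measurable; the minimal value is nevertheless almost surely a
countable infimum of measurable functions. -/
lemma aemeasurable_empiricalObjective_argmin {φ : Euc d → ℝ} (hφ : Continuous φ) {Ω : Type*}
    [MeasurableSpace Ω] {P : Measure Ω} {Z : ℕ → Ω → Euc d} (hZ : ∀ i, AEMeasurable (Z i) P)
    {n : ℕ} {X : Ω → Euc d}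
    (hX : ∀ᵐ ω ∂P, X ω ∈ argminSet (empiricalObjective (importanceIntegrand φ) n
      (fun i => Z i ω))) :
    AEMeasurable (fun ω => empiricalObjective (importanceIntegrand φ) n
      (fun i => Z i ω) (X ω)) P := by
  have h : AEMeasurable (fun ω => ⨅ k, empiricalObjective (importanceIntegrand φ) n
      (fun i => Z i ω) (TopologicalSpace.denseSeq (Euc d) k)) P := by
    refine AEMeasurable.iInf fun k => ?_
    unfold empiricalObjective
    refine (Finset.aemeasurable_fun_sum _ fun i _ => ?_).const_mul _
    exact (continuous_importanceIntegrand_right hφ _).measurable.comp_aemeasurable (hZ i)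
  refine h.congr ?_
  filter_upwards [hX] with ω hω
  exact (eq_iInf_denseSeq (continuous_empiricalObjective φ n _) hω).symm

/-! ### The error bound in expectation -/

/-- The factor 2 is for `d = 2`, where `log (1 + n) ≥ log 2 ≥ 1/2`. -/
lemma rpow_neg_half_le_rate (hd : 1 ≤ d) {n : ℕ} (hn : 1 ≤ n) :
    (n : ℝ) ^ (-(1 / 2) : ℝ) ≤ 2 * rate d n := by
  have hn1 : (1 : ℝ) ≤ n := by exact_mod_cast hn
  have hs : 0 ≤ (n : ℝ) ^ (-(1 / 2) : ℝ) := by positivity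
  unfold rate
  split_ifs with h1 h2
  · linarith
  · have h3 : 1 / 2 ≤ Real.log (1 + n) := by
      have h4 : Real.log 2 ≤ Real.log (1 + n) := Real.log_le_log two_pos (by linarith)
      linarith [Real.log_two_gt_d9]
    nlinarith
  · have h3 : (2 : ℝ) ≤ d := by exact_mod_cast (by omega : 2 ≤ d)
    have h4 : (n : ℝ) ^ (-(1 / 2) : ℝ) ≤ (n : ℝ) ^ (-(1 / (d : ℝ))) := by
      apply Real.rpow_le_rpow_of_exponent_le hn1
      have : 1 / (d : ℝ) ≤ 1 / 2 := one_div_le_one_div_of_le two_pos h3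
      linarith
    linarith

theorem integral_abs_empiricalObjective_sub_le {φ : Euc d → ℝ} (hφ : Continuous φ) {A B : ℝ}
    (hgrowth : ∀ z, |φ z| ≤ A * Real.exp (B * ‖z‖)) {xs : Euc d}
    (hxs : xs ∈ argminSet (importanceObjective φ)) (hpos : 0 < importanceObjective φ xs)
    {Ω : Type*} [MeasurableSpace Ω] {P : Measure Ω} [IsProbabilityMeasure P]
    {Z : ℕ → Ω → Euc d} (hZ : ∀ i, HasLaw (Z i) (stdGaussian (Euc d)) P)
    (hind : iIndepFun Z P) {n : ℕ} (hn : 1 ≤ n) {X : Ω → Euc d}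
    (hX : ∀ᵐ ω ∂P, X ω ∈ argminSet (empiricalObjective (importanceIntegrand φ) n
      (fun i => Z i ω))) :
    Integrable (fun ω => empiricalObjective (importanceIntegrand φ) n (fun i => Z i ω) (X ω)
      - importanceObjective φ xs) P ∧
    ∫ ω, |empiricalObjective (importanceIntegrand φ) n (fun i => Z i ω) (X ω)
      - importanceObjective φ xs| ∂P
      ≤ (1 + Var[importanceIntegrand φ xs; stdGaussian (Euc d)]
          + (∑ j, Var[importanceGradient φ xs j; stdGaussian (Euc d)])
            / importanceObjective φ xs) * (n : ℝ) ^ (-(1 / 2) : ℝ) := by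
  set m := importanceObjective φ xs with hm
  have hn1 : (1 : ℝ) ≤ n := by exact_mod_cast hn
  have hn0 : (0 : ℝ) < n := by linarith
  set s := (n : ℝ) ^ (-(1 / 2) : ℝ) with hs
  have hs0 : 0 < s := Real.rpow_pos_of_pos hn0 _
  have hss : s ^ 2 = 1 / n := by
    rw [hs, ← Real.rpow_natCast, ← Real.rpow_mul hn0.le]
    norm_num [Real.rpow_neg_one]
  have hs1 : s ≤ 1 := Real.rpow_le_one_of_one_le_of_nonpos hn1 (by norm_num)
  have hv : MemLp (importanceIntegrand φ xs) 2 (stdGaussian (Euc d)) :=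
    (expGrowth_importanceIntegrand hgrowth xs).memLp_two
      (continuous_importanceIntegrand_right hφ xs)
  have hvm := (continuous_importanceIntegrand_right hφ xs).measurable
  have hg := fun j => memLp_importanceGradient hφ hgrowth xs j
  have hgm := fun j => (continuous_importanceGradient hφ xs j).measurable
  have hI1 : Integrable (fun ω =>
      (empiricalMean (importanceIntegrand φ xs) n (fun i => Z i ω) - m) ^ 2) P :=
    ((memLp_empiricalMean hZ hv).sub (memLp_const m)).integrable_sq
  have hI2 : ∀ j, Integrable (fun ω =>
      empiricalMean (importanceGradient φ xs j) n (fun i => Z i ω) ^ 2) P := fun j =>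
    (memLp_empiricalMean hZ (hg j)).integrable_sq
  have hI2' := integrable_finsetSum Finset.univ fun j _ => hI2 j
  have hE1 : ∫ ω, (empiricalMean (importanceIntegrand φ xs) n (fun i => Z i ω) - m) ^ 2 ∂P
      = Var[importanceIntegrand φ xs; stdGaussian (Euc d)] / n :=
    integral_sq_empiricalMean_sub hZ hind hvm hv hn
  have hE2 : ∀ j, ∫ ω, empiricalMean (importanceGradient φ xs j) n (fun i => Z i ω) ^ 2 ∂P
      = Var[importanceGradient φ xs j; stdGaussian (Euc d)] / n := fun j => by
    have := integral_sq_empiricalMean_sub hZ hind (hgm j) (hg j) hn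
    simpa [integral_importanceGradient hφ hgrowth hxs j] using this
  have hI3 : Integrable (fun ω => s
      + s⁻¹ * (empiricalMean (importanceIntegrand φ xs) n (fun i => Z i ω) - m) ^ 2) P :=
    (integrable_const s).add (hI1.const_mul _)
  have hbound : Integrable (fun ω => (s
      + s⁻¹ * (empiricalMean (importanceIntegrand φ xs) n (fun i => Z i ω) - m) ^ 2)
      + (∑ j, empiricalMean (importanceGradient φ xs j) n (fun i => Z i ω) ^ 2) / m) P :=
    hI3.add (hI2'.div_const m)
  have hle : ∀ᵐ ω ∂P, |empiricalObjective (importanceIntegrand φ) n (fun i => Z i ω) (X ω) - m|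
      ≤ (s + s⁻¹ * (empiricalMean (importanceIntegrand φ xs) n (fun i => Z i ω) - m) ^ 2)
      + (∑ j, empiricalMean (importanceGradient φ xs j) n (fun i => Z i ω) ^ 2) / m := by
    filter_upwards [hX] with ω hω
    refine (abs_empiricalObjective_sub_le xs hω hpos).trans ?_
    gcongr
    change 2 * |empiricalMean (importanceIntegrand φ xs) n (fun i => Z i ω) - m| ≤ _
    rw [← sq_abs (empiricalMean _ _ _ - m)]
    set t := |empiricalMean (importanceIntegrand φ xs) n (fun i => Z i ω) - m|
    -- The inequality `2t ≤ s + t²/s` with `s = n^{-1/2}` replaces Cauchy–Schwarz: the mean of `t²`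
    -- is of order `s²`, so both terms are of order `s`.
    have h1 : 0 ≤ s⁻¹ * (t - s) ^ 2 := by positivity
    have h2 : s⁻¹ * (t - s) ^ 2 = s + s⁻¹ * t ^ 2 - 2 * t := by
      field_simp
      ring
    linarith
  have hint : Integrable (fun ω =>
      empiricalObjective (importanceIntegrand φ) n (fun i => Z i ω) (X ω) - m) P :=
    hbound.mono' ((aemeasurable_empiricalObjective_argmin hφ (fun i => (hZ i).aemeasurable)
      hX).sub_const m).aestronglyMeasurable hle
  refine ⟨hint, (integral_mono_ae hint.abs hbound hle).trans ?_⟩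
  rw [integral_add hI3 (hI2'.div_const m),
    integral_add (integrable_const s) (hI1.const_mul _), integral_const_mul, hE1,
    integral_div, integral_finsetSum _ fun j _ => hI2 j, Finset.sum_congr rfl fun j _ => hE2 j,
    ← Finset.sum_div]
  set a := Var[importanceIntegrand φ xs; stdGaussian (Euc d)]
  set b := ∑ j, Var[importanceGradient φ xs j; stdGaussian (Euc d)] with hb
  have hb0 : 0 ≤ b := Finset.sum_nonneg fun j _ => variance_nonneg _ _
  have ha : s⁻¹ * (a / n) = a * s := by
    rw [div_eq_mul_one_div, ← hss]
    field_simp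
  -- The gradient term is of order `1 / n = s²`, hence at most of order `s` as `s ≤ 1`.
  have hb' : b / n / m ≤ b / m * s := by
    rw [div_eq_mul_one_div b, ← hss]
    have : b * s ^ 2 / m = b / m * s * s := by ring
    rw [this]
    exact mul_le_of_le_one_right (by positivity) hs1
  simp only [integral_const, probReal_univ, one_smul]
  rw [ha]
  linarith

end EmpiricMinimizer

theorem mainTheorem2 (d : ℕ) (hd : 1 ≤ d) (φ : EmpiricMinimizer.Euc d → ℝ)
    (hcont : Continuous φ) (hne : ∃ z, φ z ≠ 0)
    (A B : ℝ) (hA : 0 ≤ A) (hB : 0 ≤ B)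
    (hgrowth : ∀ z, |φ z| ≤ A * Real.exp (B * ‖z‖))
    (hlip : ∀ r : ℝ, 0 < r →
      LipschitzOnWith (Real.toNNReal (A * Real.exp (B * r))) φ
        (Metric.closedBall (0 : EmpiricMinimizer.Euc d) r)) :
    EmpiricMinimizer.ConvergenceAssumptions (stdGaussian (EmpiricMinimizer.Euc d))
      (EmpiricMinimizer.importanceObjective φ) (EmpiricMinimizer.importanceIntegrand φ) ∧
    (∀ n : ℕ, 1 ≤ n → ∀ z : ℕ → EmpiricMinimizer.Euc d,
      (EmpiricMinimizer.argminSet (EmpiricMinimizer.empiricalObjective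
        (EmpiricMinimizer.importanceIntegrand φ) n z)).Nonempty) ∧
    ∃ (C : ℝ) (a : ℕ → ℝ), 0 < C ∧ (∀ n, 0 < a n) ∧
      (∀ ε : ℝ, 0 < ε → a =o[atTop] (fun n : ℕ => (n : ℝ) ^ ε)) ∧
      ∀ (Ω : Type*) [MeasurableSpace Ω] (P : Measure Ω) [IsProbabilityMeasure P]
        (Z : ℕ → Ω → EmpiricMinimizer.Euc d) (X : ℕ → Ω → EmpiricMinimizer.Euc d),
        (∀ i, HasLaw (Z i) (stdGaussian (EmpiricMinimizer.Euc d)) P) →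
        iIndepFun Z P →
        (∀ n : ℕ, 1 ≤ n → ∀ᵐ ω ∂P, X n ω ∈ EmpiricMinimizer.argminSet
          (EmpiricMinimizer.empiricalObjective (EmpiricMinimizer.importanceIntegrand φ) n
            (fun i => Z i ω))) →
        ∀ n : ℕ, 1 ≤ n →
          Integrable (fun ω => EmpiricMinimizer.empiricalObjective
              (EmpiricMinimizer.importanceIntegrand φ) n (fun i => Z i ω) (X n ω)
            - ⨅ x, EmpiricMinimizer.importanceObjective φ x) P ∧
          ∫ ω, |EmpiricMinimizer.empiricalObjective
              (EmpiricMinimizer.importanceIntegrand φ) n (fun i => Z i ω) (X n ω)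
            - ⨅ x, EmpiricMinimizer.importanceObjective φ x| ∂P
            ≤ C * a n * EmpiricMinimizer.rate d n := by
  have hconv := EmpiricMinimizer.convergenceAssumptions_importance hd hcont hne hA hB hgrowth hlip
  refine ⟨hconv, fun n hn z => EmpiricMinimizer.argminSet_empiricalObjective_nonempty φ hn z, ?_⟩
  obtain ⟨xs, hxs, -⟩ := hconv.second_moment
  have hinf : ⨅ x, EmpiricMinimizer.importanceObjective φ x
      = EmpiricMinimizer.importanceObjective φ xs :=
    le_antisymm (ciInf_le ⟨_, Set.forall_mem_range.2 hxs⟩ xs) (le_ciInf hxs)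
  rw [hinf]
  have hpos := hconv.pos_V xs
  -- `D` depends only on `φ`, `d` and the chosen `xs`, so it is uniform over probability spaces,
  -- samples and selections of minimizers.
  set D := 1 + Var[EmpiricMinimizer.importanceIntegrand φ xs;
      stdGaussian (EmpiricMinimizer.Euc d)]
    + (∑ j, Var[EmpiricMinimizer.importanceGradient φ xs j;
      stdGaussian (EmpiricMinimizer.Euc d)]) / EmpiricMinimizer.importanceObjective φ xs with hD
  have hD0 : 0 < D := by
    have h1 := variance_nonneg (EmpiricMinimizer.importanceIntegrand φ xs)
      (stdGaussian (EmpiricMinimizer.Euc d))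
    have h2 : 0 ≤ (∑ j, Var[EmpiricMinimizer.importanceGradient φ xs j;
        stdGaussian (EmpiricMinimizer.Euc d)]) / EmpiricMinimizer.importanceObjective φ xs :=
      div_nonneg (Finset.sum_nonneg fun j _ => variance_nonneg _ _) hpos.le
    linarith
  refine ⟨D * 2, fun _ => 1, by positivity, fun _ => one_pos, fun ε hε => ?_, ?_⟩
  · exact isLittleO_const_left.2 (Or.inr (tendsto_norm_atTop_atTop.comp
      ((tendsto_rpow_atTop hε).comp tendsto_natCast_atTop_atTop)))
  · intro Ω _ P _ Z X hZ hind hX n hn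
    obtain ⟨hint, hle⟩ := EmpiricMinimizer.integral_abs_empiricalObjective_sub_le hcont hgrowth
      hxs hpos hZ hind hn (hX n hn)
    refine ⟨hint, hle.trans ?_⟩
    rw [mul_one, mul_assoc]
    exact mul_le_mul_of_nonneg_left (EmpiricMinimizer.rpow_neg_half_le_rate hd hn) hD0.le
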